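/- Let $\Bbbk$ be an ordered field, and let $P_1(z)=\rho_0+\rho_1z+\cdots+\rho_{d_1}z^{d_1}$ and $P_2(z)=\varrho_0+\varrho_1z+\cdots+\varrho_{d_2}z^{d_2}$ be monic palindromic polynomials over $\Bbbk$ of degrees $d_1,d_2\ge 0$ with nonnegative coefficients (palindromic means $z^{d_i}P_i(z^{-1})=P_i(z)$). Write $[a]_+=\max(a,0)$, and write $(k_1,\ldots,k_r)\vdash k$ for $k_1,\ldots,k_r\in\mathbb{Z}_{\ge0}$ with $k_1+\cdots+k_r=k$. For $n,k_0\in\mathbb{Z}$ and $k_1,\ldots,k_r\in\mathbb{Z}_{\ge 0}$ with $k_0+k_1+\cdots+k_r=n$, set $$\binom{n}{k_0,k_1,\ldots,k_r}=\binom{n}{k}\frac{k!}{k_1!\cdots k_r!},\qquad k=k_1+\cdots+k_r,\qquad \binom nk=\frac{n(n-1)\cdots(n-k+1)}{k!}.$$ Fix $(a_1,a_2)\in\mathbb{Z}^2$. For a function $c$ on $\mathbb{Z}_{\ge0}^2$, extended by zero to arguments with a negative entry, put $$V_c(p,q)=\sum_{k=1}^p\ \sum_{(k_1,\ldots,k_{d_2})\vdash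 k}(-1)^{k-1}c(p-k_1-2k_2-\cdots-d_2k_{d_2},\,q)\,\varrho_1^{k_1}\cdots\varrho_{d_2}^{k_{d_2}}\binom{a_2-q+k-1}{a_2-q-1,\,k_1,\ldots,k_{d_2}},$$ $$H_c(p,q)=\sum_{\ell=1}^q\ \sum_{(\ell_1,\ldots,\ell_{d_1})\vdash \ell}(-1)^{\ell-1}c(p,\,q-\ell_1-2\ell_2-\cdots-d_1\ell_{d_1})\,\rho_1^{\ell_1}\cdots\rho_{d_1}^{\ell_{d_1}}\binom{a_1-p+\ell-1}{a_1-p-1,\,\ell_1,\ldots,\ell_{d_1}}.$$ Define the greedy coefficients $c(p,q)\in\Bbbk$, $(p,q)\in\mathbb{Z}_{\ge0}^2$, by $c(0,0)=1$ and the recursion $$c(p,q)=\max\big([V_c(p,q)]_+,\ [H_c(p,q)]_+\big)\qquad\text{for } (p,q)\neq(0,0).$$ (The values of $c$ occurring in $V_c(p,q)$ and $H_c(p,q)$ precede $c(p,q)$, so this determines $c$.) Then for each $(p,q)\in\mathbb{Z}_{\ge0}^2\setminus\{(0,0)\}$, $$c(p,q)=\begin{cases}[V_c(p,q)]_+ &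 \text{if } a_1q\le a_2p,\\ [H_c(p,q)]_+ & \text{if } a_1q\ge a_2p.\end{cases}$$ In particular, both expressions agree when $a_1q=a_2p$. -/

import Mathlib

open Polynomial

/-- The multinomial coefficient `(n choose k₀, κ₁, …, κᵣ)` for integers `n`, `k₀` and natural
numbers `κ₁, …, κᵣ`: if `k₀ + κ₁ + ⋯ + κᵣ = n`, it is `(n choose k) * (k choose κ₁, …, κᵣ)` with
`k = κ₁ + ⋯ + κᵣ = n - k₀`, where `(n choose k) = n (n - 1) ⋯ (n - k + 1) / k!` for `n ∈ ℤ`;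
otherwise it is zero. -/
noncomputable def intMultinomial {r : ℕ} (n k₀ : ℤ) (κ : Fin r → ℕ) : ℤ :=
  if k₀ + ((∑ i, κ i : ℕ) : ℤ) = n then
    Ring.choose n (∑ i, κ i) * (Nat.multinomial Finset.univ κ : ℤ)
  else 0

/-- The number `κ₁ + 2 κ₂ + ⋯ + r κᵣ`. The entry `κᵢ₊₁` is `κ i`, as `i : Fin r` starts from 0. -/
def partWeight {r : ℕ} (κ : Fin r → ℕ) : ℕ :=
  ∑ i : Fin r, (i.val + 1) * κ i

/-- For a polynomial `P = ρ₀ + ρ₁ z + ⋯ + ρ_d z ^ d` of degree `d`, an integer `N` and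
`f : ℕ → 𝕜`, extended by zero to negative arguments, this is
`∑_{k = 1}^{n} ∑_{κ₁ + ⋯ + κ_d = k} (-1) ^ (k - 1) * f (n - κ₁ - 2 κ₂ - ⋯ - d κ_d)
  * ρ₁ ^ κ₁ ⋯ ρ_d ^ κ_d * (N + k - 1 choose N - 1, κ₁, …, κ_d)`. -/
noncomputable def greedySum {𝕜 : Type*} [Field 𝕜] (P : 𝕜[X]) (N : ℤ) (f : ℕ → 𝕜) (n : ℕ) : 𝕜 :=
  ∑ k ∈ Finset.Icc 1 n,
    ∑ κ ∈ Finset.piAntidiag (Finset.univ : Finset (Fin P.natDegree)) k,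
      (-1) ^ (k - 1) * (if partWeight κ ≤ n then f (n - partWeight κ) else 0)
        * (∏ i : Fin P.natDegree, P.coeff (i.val + 1) ^ κ i)
        * (intMultinomial (N + (k : ℤ) - 1) (N - 1) κ : 𝕜)

theorem le_partWeight {r k : ℕ} {κ : Fin r → ℕ}
    (h : κ ∈ Finset.piAntidiag (Finset.univ : Finset (Fin r)) k) : k ≤ partWeight κ := by
  rw [Finset.mem_piAntidiag] at h
  rw [← h.1]
  exact Finset.sum_le_sum fun i _ => Nat.le_mul_of_pos_left _ (Nat.succ_pos _)

/-- The sum `greedySum P N f n` only involves the values of `f` below `n`. -/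
theorem greedySum_congr {𝕜 : Type*} [Field 𝕜] (P : 𝕜[X]) (N : ℤ) {f g : ℕ → 𝕜} {n : ℕ}
    (h : ∀ m < n, f m = g m) : greedySum P N f n = greedySum P N g n := by
  refine Finset.sum_congr rfl fun k hk => Finset.sum_congr rfl fun κ hκ => ?_
  have h1 := le_partWeight hκ
  have h2 := (Finset.mem_Icc.mp hk).1
  by_cases hw : partWeight κ ≤ n
  · rw [if_pos hw, if_pos hw, h _ (by omega)]
  · rw [if_neg hw, if_neg hw]

/-- The greedy coefficients `c(p, q)`, defined by `c(0, 0) = 1` and the greedy recursion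
(see `greedyCoeff_of_ne_zero` for the recursion without the tests `p' < p` and `q' < q`, which
only serve to make the recursion visibly well-founded). -/
noncomputable def greedyCoeff {𝕜 : Type*} [Field 𝕜] [LinearOrder 𝕜] (P₁ P₂ : 𝕜[X]) (a₁ a₂ : ℤ)
    (p q : ℕ) : 𝕜 :=
  if p = 0 ∧ q = 0 then 1
  else
    max
      (max (greedySum P₂ (a₂ - (q : ℤ))
        (fun p' => if p' < p then greedyCoeff P₁ P₂ a₁ a₂ p' q else 0) p) 0)
      (max (greedySum P₁ (a₁ - (p : ℤ))
        (fun q' => if q' < q then greedyCoeff P₁ P₂ a₁ a₂ p q' else 0) q) 0)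
termination_by p + q

theorem greedyCoeff_zero {𝕜 : Type*} [Field 𝕜] [LinearOrder 𝕜] (P₁ P₂ : 𝕜[X]) (a₁ a₂ : ℤ) :
    greedyCoeff P₁ P₂ a₁ a₂ 0 0 = 1 := by
  rw [greedyCoeff, if_pos ⟨rfl, rfl⟩]

/-- The greedy recursion. -/
theorem greedyCoeff_of_ne_zero {𝕜 : Type*} [Field 𝕜] [LinearOrder 𝕜] (P₁ P₂ : 𝕜[X])
    (a₁ a₂ : ℤ) (p q : ℕ) (h : ¬(p = 0 ∧ q = 0)) :
    greedyCoeff P₁ P₂ a₁ a₂ p q =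
      max
        (max (greedySum P₂ (a₂ - (q : ℤ)) (fun p' => greedyCoeff P₁ P₂ a₁ a₂ p' q) p) 0)
        (max (greedySum P₁ (a₁ - (p : ℤ)) (fun q' => greedyCoeff P₁ P₂ a₁ a₂ p q') q) 0) := by
  rw [greedyCoeff, if_neg h]
  congr 2
  · exact greedySum_congr _ _ fun m hm => if_pos hm
  · exact greedySum_congr _ _ fun m hm => if_pos hm

/-! The sum `greedySum P N f n` is `f n` minus the coefficient of `z ^ n` in `(∑ f m z ^ m) * P ^
(-N)` (`greedySum_eq_sub`). So `c ≥ H` says that a coefficient of column `p`, multiplied by `P₁ ^ (p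
- a₁)`, is nonnegative, and `c = H` says that it vanishes; likewise for `V` and rows. The recursion
has only one solution, so it is enough to exhibit nonnegative `c` dominating both sums, with
equality, wherever `c ≠ 0`, on the side of the line `a₁ q = a₂ p` prescribed by the theorem
(`IsGreedySolution`).

If `a₂ ≤ 0`, the column `p = 0` carries the coefficients of a power of `P₁` and all else is zero;
`a₁ ≤ 0` is symmetric. If both are positive, `c(p, q)` is a weighted count of compatible gradings on
the cyclic Christoffel path with `a₁` horizontal and `a₂` vertical edges, cut off to zero when `p ≥
a₁` and `q ≥ a₂`.

For a vertical grading of total `p ≤ a₁`, exactly `a₁ - p` horizontal edges lie outside all shadows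
(`card_freeSet_add`), and compatibility ignores the values on them (`Compatible.congr`). Hence
column `p` is `P₁ ^ (a₁ - p)` times a series with nonnegative coefficients (`mk_compatibleSum`), and
those coefficients are the differences `c - H`. The slope of the path makes them vanish when `a₂ p ≤
a₁ q` (`Compatible.mul_lt_mul`). Reversing the path exchanges the two directions. -/

theorem intMultinomial_eq_choose {r k : ℕ} (N : ℤ) {κ : Fin r → ℕ}
    (h : κ ∈ Finset.piAntidiag (Finset.univ : Finset (Fin r)) k) :
    intMultinomial (N + (k : ℤ) - 1) (N - 1) κ =
      Ring.choose (N + (k : ℤ) - 1) k * (Nat.multinomial Finset.univ κ : ℤ) := by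
  rw [Finset.mem_piAntidiag] at h
  have hs : ∑ i, κ i = k := h.1
  rw [intMultinomial, hs, if_pos (by ring)]

/-! ### Greedy sums as coefficients of products with powers of `P`. -/

section Powers

variable {𝕜 : Type*} [Field 𝕜]

/-- The partial sum up to degree `B` of the expansion of `(1 + Q) ^ (-N)` in powers of `Q`. -/
noncomputable def negPowPartialSum (Q : PowerSeries 𝕜) (N : ℤ) (B : ℕ) : PowerSeries 𝕜 :=
  ∑ k ∈ Finset.range (B + 1),
    (((-1) ^ k * Ring.choose (N + (k : ℤ) - 1) k : ℤ) : PowerSeries 𝕜) * Q ^ k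

/-- Pascal's rule makes the product telescope; only the top term is left over. -/
theorem negPowPartialSum_mul (Q : PowerSeries 𝕜) (N : ℤ) (B : ℕ) :
    negPowPartialSum Q N B * (1 + Q) = negPowPartialSum Q (N - 1) B +
      (((-1) ^ B * Ring.choose (N + (B : ℤ) - 1) B : ℤ) : PowerSeries 𝕜) * Q ^ (B + 1) := by
  induction B with
  | zero => simp [negPowPartialSum]
  | succ B ih =>
    unfold negPowPartialSum at ih ⊢
    rw [Finset.sum_range_succ, add_mul, ih, Finset.sum_range_succ _ (B + 1)]
    have hp : Ring.choose (N + ((B + 1 : ℕ) : ℤ) - 1) (B + 1) =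
        Ring.choose (N + (B : ℤ) - 1) B + Ring.choose (N - 1 + ((B + 1 : ℕ) : ℤ) - 1) (B + 1) := by
      have h := Ring.choose_succ_succ (N + (B : ℤ) - 1) B
      rw [show N + ((B + 1 : ℕ) : ℤ) - 1 = N + (B : ℤ) - 1 + 1 by push_cast; ring, h,
        show N - 1 + ((B + 1 : ℕ) : ℤ) - 1 = N + (B : ℤ) - 1 by push_cast; ring]
    rw [hp]
    push_cast
    ring

/-- Since `Q` has no constant term, the leftover is invisible up to degree `B`. Truncated sums thus
obey the laws of exponents, with no need to invert `1 + Q`. -/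
theorem X_pow_dvd_negPowPartialSum_mul_sub (Q : PowerSeries 𝕜) (hQ : PowerSeries.X ∣ Q) (N : ℤ)
    (B : ℕ) : (PowerSeries.X : PowerSeries 𝕜) ^ (B + 1) ∣
      negPowPartialSum Q N B * (1 + Q) - negPowPartialSum Q (N - 1) B := by
  rw [negPowPartialSum_mul, add_sub_cancel_left]
  exact (pow_dvd_pow_of_dvd hQ _).mul_left _

theorem negPowPartialSum_zero (Q : PowerSeries 𝕜) (B : ℕ) : negPowPartialSum Q 0 B = 1 := by
  unfold negPowPartialSum
  rw [Finset.sum_range_succ', Finset.sum_eq_zero]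
  · simp
  · intro k _
    have : Ring.choose (0 + ((k + 1 : ℕ) : ℤ) - 1) (k + 1) = 0 := by
      rw [show 0 + ((k + 1 : ℕ) : ℤ) - 1 = (k : ℤ) by push_cast; ring, Ring.choose_natCast,
        Nat.choose_succ_self, Nat.cast_zero]
    rw [this]
    simp

theorem X_pow_dvd_negPowPartialSum_mul_pow_sub_one (Q : PowerSeries 𝕜) (hQ : PowerSeries.X ∣ Q)
    (N B : ℕ) : (PowerSeries.X : PowerSeries 𝕜) ^ (B + 1) ∣
      negPowPartialSum Q N B * (1 + Q) ^ N - 1 := by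
  induction N with
  | zero => simp [negPowPartialSum_zero]
  | succ N ih =>
    have h := (X_pow_dvd_negPowPartialSum_mul_sub Q hQ ((N + 1 : ℕ) : ℤ) B).mul_right ((1 + Q) ^ N)
    rw [show ((N + 1 : ℕ) : ℤ) - 1 = N by push_cast; ring] at h
    have := dvd_add h ih
    convert this using 1
    ring

theorem X_pow_dvd_negPowPartialSum_sub_pow (Q : PowerSeries 𝕜) (hQ : PowerSeries.X ∣ Q)
    (M B : ℕ) : (PowerSeries.X : PowerSeries 𝕜) ^ (B + 1) ∣
      negPowPartialSum Q (-(M : ℤ)) B - (1 + Q) ^ M := by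
  induction M with
  | zero => simp [negPowPartialSum_zero]
  | succ M ih =>
    have h := X_pow_dvd_negPowPartialSum_mul_sub Q hQ (-(M : ℤ)) B
    rw [show -(M : ℤ) - 1 = -((M + 1 : ℕ) : ℤ) by push_cast; ring] at h
    have := dvd_sub (ih.mul_right (1 + Q)) h
    convert this using 1
    ring

theorem coeff_mul_congr_of_X_pow_dvd_sub {F S T : PowerSeries 𝕜} {n : ℕ}
    (h : (PowerSeries.X : PowerSeries 𝕜) ^ (n + 1) ∣ S - T) :
    PowerSeries.coeff n (F * S) = PowerSeries.coeff n (F * T) := by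
  have h' := h.mul_left F
  rw [PowerSeries.X_pow_dvd_iff] at h'
  have := h' n (Nat.lt_succ_self n)
  rw [mul_sub, map_sub, sub_eq_zero] at this
  exact this

theorem coe_sub_one_eq_sum (P : 𝕜[X]) (hP : P.coeff 0 = 1) :
    (P : PowerSeries 𝕜) - 1 = ∑ i : Fin P.natDegree,
      PowerSeries.C (P.coeff (i.val + 1)) * PowerSeries.X ^ (i.val + 1) := by
  have h := P.as_sum_range_C_mul_X_pow
  rw [Finset.sum_range_succ', hP] at h
  rw [Finset.sum_fin_eq_sum_range]
  conv_lhs => rw [h]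
  have : ∀ s : Finset ℕ, ∀ u : ℕ → 𝕜[X],
      ((∑ i ∈ s, u i : 𝕜[X]) : PowerSeries 𝕜) = ∑ i ∈ s, (u i : PowerSeries 𝕜) := fun s u =>
    map_sum (Polynomial.coeToPowerSeries.ringHom (R := 𝕜)) u s
  rw [Polynomial.coe_add, this]
  simp only [map_one, pow_zero, mul_one, Polynomial.coe_one, add_sub_cancel_right]
  refine Finset.sum_congr rfl fun i hi => ?_
  rw [dif_pos (Finset.mem_range.mp hi)]
  simp

theorem X_dvd_coe_sub_one (P : 𝕜[X]) (hP : P.coeff 0 = 1) :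
    (PowerSeries.X : PowerSeries 𝕜) ∣ (P : PowerSeries 𝕜) - 1 := by
  rw [PowerSeries.X_dvd_iff]
  rw [map_sub, Polynomial.constantCoeff_coe, hP, map_one, sub_self]

/-- The multinomial theorem: choosing `κ i` factors of degree `i + 1` shifts the index by
`partWeight κ`. -/
theorem coeff_mul_sub_one_pow (P : 𝕜[X]) (hP : P.coeff 0 = 1) (f : ℕ → 𝕜) (n k : ℕ) :
    PowerSeries.coeff n (PowerSeries.mk f * ((P : PowerSeries 𝕜) - 1) ^ k) =
      ∑ κ ∈ Finset.piAntidiag (Finset.univ : Finset (Fin P.natDegree)) k,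
        (if partWeight κ ≤ n then f (n - partWeight κ) else 0)
        * (∏ i : Fin P.natDegree, P.coeff (i.val + 1) ^ κ i)
        * (Nat.multinomial Finset.univ κ : 𝕜) := by
  rw [coe_sub_one_eq_sum P hP, Finset.sum_pow_eq_sum_piAntidiag, Finset.mul_sum, map_sum]
  refine Finset.sum_congr rfl fun κ _ => ?_
  have h : ∏ i : Fin P.natDegree,
      (PowerSeries.C (P.coeff (i.val + 1)) * PowerSeries.X ^ (i.val + 1) : PowerSeries 𝕜) ^ κ i =
      PowerSeries.C (∏ i : Fin P.natDegree, P.coeff (i.val + 1) ^ κ i) *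
        PowerSeries.X ^ partWeight κ := by
    simp_rw [mul_pow, Finset.prod_mul_distrib, ← pow_mul, Finset.prod_pow_eq_pow_sum, map_prod,
      map_pow, partWeight]
  rw [h]
  have h2 : PowerSeries.mk f * ((Nat.multinomial Finset.univ κ : PowerSeries 𝕜) *
      (PowerSeries.C (∏ i : Fin P.natDegree, P.coeff (i.val + 1) ^ κ i) *
        PowerSeries.X ^ partWeight κ)) =
      PowerSeries.C ((∏ i : Fin P.natDegree, P.coeff (i.val + 1) ^ κ i) *
        (Nat.multinomial Finset.univ κ : 𝕜)) *
        (PowerSeries.mk f * PowerSeries.X ^ partWeight κ) := by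
    rw [map_mul, map_natCast]
    ring
  rw [h2, PowerSeries.coeff_C_mul, PowerSeries.coeff_mul_X_pow', PowerSeries.coeff_mk]
  ring

/-- `greedySum P N f n` is `f n` minus the coefficient of `z ^ n` in `(∑ f m z ^ m) P ^ (-N)`. -/
theorem greedySum_eq_sub (P : 𝕜[X]) (hP : P.coeff 0 = 1) (N : ℤ) (f : ℕ → 𝕜) (n : ℕ) :
    greedySum P N f n = f n -
      PowerSeries.coeff n (PowerSeries.mk f * negPowPartialSum ((P : PowerSeries 𝕜) - 1) N n) := by
  rw [negPowPartialSum, Finset.mul_sum, map_sum, Finset.sum_range_succ', greedySum,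
    ← Finset.Ico_add_one_right_eq_Icc, Finset.sum_Ico_eq_sum_range]
  -- The term `k = 0` is `f n`; the terms `1 ≤ k ≤ n` are those of the greedy sum with opposite
  -- sign.
  have h0 : PowerSeries.coeff n (PowerSeries.mk f *
      ((((-1) ^ 0 * Ring.choose (N + ((0 : ℕ) : ℤ) - 1) 0 : ℤ) : PowerSeries 𝕜) *
        ((P : PowerSeries 𝕜) - 1) ^ 0)) = f n := by
    simp
  rw [h0, sub_add_cancel_right, ← Finset.sum_neg_distrib]
  refine Finset.sum_congr rfl fun k _ => ?_
  rw [mul_left_comm, ← zsmul_eq_mul, map_zsmul, zsmul_eq_mul, coeff_mul_sub_one_pow P hP,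
    Finset.mul_sum, ← Finset.sum_neg_distrib, add_comm 1 k]
  refine Finset.sum_congr rfl fun κ hκ => ?_
  rw [intMultinomial_eq_choose N hκ, Nat.add_sub_cancel]
  push_cast
  ring

theorem sub_greedySum_of_mk_eq_mul_pow (P : 𝕜[X]) (hP : P.coeff 0 = 1) (N : ℕ) (f : ℕ → 𝕜)
    (E : PowerSeries 𝕜) (h : PowerSeries.mk f = E * (P : PowerSeries 𝕜) ^ N) (n : ℕ) :
    f n - greedySum P N f n = PowerSeries.coeff n E := by
  have key := X_pow_dvd_negPowPartialSum_mul_pow_sub_one _ (X_dvd_coe_sub_one P hP) N n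
  rw [greedySum_eq_sub P hP, sub_sub_cancel, h, mul_assoc, mul_comm (_ ^ N)]
  rw [add_sub_cancel] at key
  rw [coeff_mul_congr_of_X_pow_dvd_sub key, mul_one]

theorem sub_greedySum_neg (P : 𝕜[X]) (hP : P.coeff 0 = 1) (M : ℕ) (f : ℕ → 𝕜) (n : ℕ) :
    f n - greedySum P (-(M : ℤ)) f n =
      PowerSeries.coeff n (PowerSeries.mk f * (P : PowerSeries 𝕜) ^ M) := by
  have key := X_pow_dvd_negPowPartialSum_sub_pow _ (X_dvd_coe_sub_one P hP) M n
  rw [greedySum_eq_sub P hP, sub_sub_cancel]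
  rw [add_sub_cancel] at key
  exact coeff_mul_congr_of_X_pow_dvd_sub key

end Powers

/-! ### Positivity and uniqueness of solutions. -/

section Nonneg

variable {𝕜 : Type*} [Field 𝕜] [LinearOrder 𝕜] [IsStrictOrderedRing 𝕜]

theorem coeff_mul_nonneg {F G : PowerSeries 𝕜} (hF : ∀ n, 0 ≤ PowerSeries.coeff n F)
    (hG : ∀ n, 0 ≤ PowerSeries.coeff n G) (n : ℕ) : 0 ≤ PowerSeries.coeff n (F * G) := by
  rw [PowerSeries.coeff_mul]
  exact Finset.sum_nonneg fun i _ => mul_nonneg (hF _) (hG _)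

theorem coeff_pow_nonneg {F : PowerSeries 𝕜} (hF : ∀ n, 0 ≤ PowerSeries.coeff n F) (N n : ℕ) :
    0 ≤ PowerSeries.coeff n (F ^ N) := by
  induction N generalizing n with
  | zero => rw [pow_zero, PowerSeries.coeff_one]; split_ifs <;> simp
  | succ N ih => rw [pow_succ]; exact coeff_mul_nonneg ih hF n

theorem sub_greedySum_nonneg_of_nonpos (P : 𝕜[X]) (hP : P.coeff 0 = 1)
    (hP' : ∀ i, 0 ≤ P.coeff i) {N : ℤ} (hN : N ≤ 0) (f : ℕ → 𝕜) (hf : ∀ i, 0 ≤ f i) (n : ℕ) :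
    0 ≤ f n - greedySum P N f n := by
  obtain ⟨M, rfl⟩ := Int.exists_eq_neg_ofNat hN
  rw [sub_greedySum_neg P hP]
  exact coeff_mul_nonneg (by simpa using hf) (coeff_pow_nonneg (by simpa using hP') M) n

end Nonneg

/-- The properties of a solution `c` of the greedy recursion that determine it. -/
structure IsGreedySolution {𝕜 : Type*} [Field 𝕜] [LinearOrder 𝕜] (P₁ P₂ : 𝕜[X]) (a₁ a₂ : ℤ)
    (c : ℕ → ℕ → 𝕜) : Prop where
  zero_zero : c 0 0 = 1
  nonneg : ∀ p q, 0 ≤ c p q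
  horizontal_le : ∀ p q : ℕ, greedySum P₂ (a₂ - (q : ℤ)) (fun p' => c p' q) p ≤ c p q
  vertical_le : ∀ p q : ℕ, greedySum P₁ (a₁ - (p : ℤ)) (fun q' => c p q') q ≤ c p q
  eq_horizontal : ∀ p q : ℕ, ¬(p = 0 ∧ q = 0) → a₁ * (q : ℤ) ≤ a₂ * (p : ℤ) → c p q ≠ 0 →
    c p q = greedySum P₂ (a₂ - (q : ℤ)) (fun p' => c p' q) p
  eq_vertical : ∀ p q : ℕ, ¬(p = 0 ∧ q = 0) → a₂ * (p : ℤ) ≤ a₁ * (q : ℤ) → c p q ≠ 0 →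
    c p q = greedySum P₁ (a₁ - (p : ℤ)) (fun q' => c p q') q

namespace IsGreedySolution

variable {𝕜 : Type*} [Field 𝕜] [LinearOrder 𝕜] {P₁ P₂ : 𝕜[X]} {a₁ a₂ : ℤ} {c : ℕ → ℕ → 𝕜}

theorem swap (h : IsGreedySolution P₁ P₂ a₁ a₂ c) :
    IsGreedySolution P₂ P₁ a₂ a₁ (fun p q => c q p) where
  zero_zero := h.zero_zero
  nonneg p q := h.nonneg q p
  horizontal_le p q := h.vertical_le q p
  vertical_le p q := h.horizontal_le q p
  eq_horizontal p q h0 := h.eq_vertical q p (fun h' => h0 h'.symm)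
  eq_vertical p q h0 := h.eq_horizontal q p (fun h' => h0 h'.symm)

theorem eq_max_horizontal (h : IsGreedySolution P₁ P₂ a₁ a₂ c) {p q : ℕ} (h0 : ¬(p = 0 ∧ q = 0))
    (hpq : a₁ * (q : ℤ) ≤ a₂ * (p : ℤ)) :
    c p q = max (greedySum P₂ (a₂ - (q : ℤ)) (fun p' => c p' q) p) 0 := by
  by_cases hc : c p q = 0
  · rw [max_eq_right (hc ▸ h.horizontal_le p q), hc]
  · rw [← h.eq_horizontal p q h0 hpq hc, max_eq_left (h.nonneg p q)]

theorem eq_max_vertical (h : IsGreedySolution P₁ P₂ a₁ a₂ c) {p q : ℕ} (h0 : ¬(p = 0 ∧ q = 0))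
    (hpq : a₂ * (p : ℤ) ≤ a₁ * (q : ℤ)) :
    c p q = max (greedySum P₁ (a₁ - (p : ℤ)) (fun q' => c p q') q) 0 :=
  h.swap.eq_max_horizontal (fun h' => h0 h'.symm) hpq

theorem eq_max_max (h : IsGreedySolution P₁ P₂ a₁ a₂ c) {p q : ℕ} (h0 : ¬(p = 0 ∧ q = 0)) :
    c p q = max (max (greedySum P₂ (a₂ - (q : ℤ)) (fun p' => c p' q) p) 0)
      (max (greedySum P₁ (a₁ - (p : ℤ)) (fun q' => c p q') q) 0) := by
  rcases le_total (a₁ * (q : ℤ)) (a₂ * (p : ℤ)) with hpq | hpq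
  · rw [← h.eq_max_horizontal h0 hpq, eq_comm]
    exact max_eq_left (max_le (h.vertical_le p q) (h.nonneg p q))
  · rw [← h.eq_max_vertical h0 hpq, eq_comm]
    exact max_eq_right (max_le (h.horizontal_le p q) (h.nonneg p q))

/-- Both functions satisfy the same recursion, whose sums involve only values with smaller `p + q`.
-/
theorem greedyCoeff_eq (h : IsGreedySolution P₁ P₂ a₁ a₂ c) (p q : ℕ) :
    greedyCoeff P₁ P₂ a₁ a₂ p q = c p q := by
  induction hn : p + q using Nat.strong_induction_on generalizing p q with
  | _ n ih =>
    by_cases h0 : p = 0 ∧ q = 0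
    · obtain ⟨rfl, rfl⟩ := h0
      rw [greedyCoeff_zero, h.zero_zero]
    · rw [greedyCoeff_of_ne_zero _ _ _ _ _ _ h0, h.eq_max_max h0]
      congr 2
      · exact greedySum_congr _ _ fun m hm => ih (m + q) (by omega) m q rfl
      · exact greedySum_congr _ _ fun m hm => ih (p + m) (by omega) p m rfl

end IsGreedySolution

/-! ### The case where `a₂` is nonpositive. -/

section NonposDenominator

variable {𝕜 : Type*} [Field 𝕜] [LinearOrder 𝕜] [IsStrictOrderedRing 𝕜]

theorem isGreedySolution_of_nonpos (P₁ P₂ : 𝕜[X]) (hP₁ : P₁.coeff 0 = 1) (hP₂ : P₂.coeff 0 = 1)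
    (hP₁' : ∀ i, 0 ≤ P₁.coeff i) (hP₂' : ∀ i, 0 ≤ P₂.coeff i) (a₁ a₂ : ℤ) (ha : a₂ ≤ 0) :
    IsGreedySolution P₁ P₂ a₁ a₂
      (fun p q => if p = 0 then PowerSeries.coeff q ((P₁ : PowerSeries 𝕜) ^ a₁.toNat) else 0) := by
  have hnn : ∀ p q : ℕ, 0 ≤ (if p = 0 then
      PowerSeries.coeff q ((P₁ : PowerSeries 𝕜) ^ a₁.toNat) else 0) := fun p q => by
    split_ifs
    · exact coeff_pow_nonneg (by simpa using hP₁') _ _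
    · exact le_rfl
  have hcol : ∀ q : ℕ, 0 < a₁ → PowerSeries.coeff q ((P₁ : PowerSeries 𝕜) ^ a₁.toNat) -
      greedySum P₁ a₁ (fun q' => PowerSeries.coeff q' ((P₁ : PowerSeries 𝕜) ^ a₁.toNat)) q =
      PowerSeries.coeff q (1 : PowerSeries 𝕜) := fun q ha₁ => by
    have := sub_greedySum_of_mk_eq_mul_pow P₁ hP₁ a₁.toNat
      (fun q' => PowerSeries.coeff q' ((P₁ : PowerSeries 𝕜) ^ a₁.toNat)) 1
      (by rw [one_mul]; ext; simp) q
    rwa [Int.toNat_of_nonneg ha₁.le] at this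
  refine ⟨?_, hnn, fun p (q : ℕ) => ?_, fun (p : ℕ) q => ?_, fun p q h0 hpq hc => ?_, fun p q h0 hpq hc => ?_⟩
  · simp [hP₁]
  · exact sub_nonneg.mp (sub_greedySum_nonneg_of_nonpos P₂ hP₂ hP₂' (by omega)
      (fun p' => if p' = 0 then PowerSeries.coeff q ((P₁ : PowerSeries 𝕜) ^ a₁.toNat) else 0)
      (fun i => hnn i q) p)
  · by_cases hp : p = 0
    · subst hp
      by_cases ha₁ : a₁ ≤ 0
      · exact sub_nonneg.mp (sub_greedySum_nonneg_of_nonpos P₁ hP₁ hP₁' (by simpa using ha₁) _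
          (fun i => hnn 0 i) q)
      · simp only [if_true, Nat.cast_zero, sub_zero]
        rw [← sub_nonneg, hcol q (by omega), PowerSeries.coeff_one]
        split_ifs <;> simp
    · simp only [hp, if_false]
      simp [greedySum]
  -- A nonzero value away from the origin has `p = 0`, `q > 0` and `a₁ > 0`, contradicting `a₁ q ≤
  -- 0`.
  · exfalso
    rw [ne_eq, ite_eq_right_iff, Classical.not_imp] at hc
    obtain ⟨rfl, hc⟩ := hc
    rcases le_or_gt a₁ 0 with ha₁ | ha₁
    · rw [Int.toNat_of_nonpos ha₁, pow_zero, PowerSeries.coeff_one, ite_eq_right_iff] at hc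
      exact h0 ⟨rfl, by_contra fun h => hc fun h' => absurd h' h⟩
    · have hq : 0 < (q : ℤ) := by omega
      have := mul_pos ha₁ hq
      simp only [Nat.cast_zero, mul_zero] at hpq
      omega
  · rw [ne_eq, ite_eq_right_iff, Classical.not_imp] at hc
    obtain ⟨rfl, hc⟩ := hc
    rcases le_or_gt a₁ 0 with ha₁ | ha₁
    · rw [Int.toNat_of_nonpos ha₁, pow_zero, PowerSeries.coeff_one, ite_eq_right_iff] at hc
      exact absurd ⟨rfl, by_contra fun h => hc fun h' => absurd h' h⟩ h0
    · simp only [if_true, Nat.cast_zero, sub_zero]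
      rw [← sub_eq_zero, hcol q ha₁, PowerSeries.coeff_one, if_neg (fun h => h0 ⟨rfl, h⟩)]

end NonposDenominator

/-! ### Functions on `ℤ` with periodic differences. -/

section Potential

/-- The function on `ℤ` that vanishes at `0` and has the differences `u`. -/
def prefixSum (u : ℤ → ℤ) : ℤ → ℤ
  | .ofNat m => ∑ i ∈ Finset.range m, u i
  | .negSucc m => -∑ i ∈ Finset.range (m + 1), u (-((i : ℤ) + 1))

theorem prefixSum_zero (u : ℤ → ℤ) : prefixSum u 0 = 0 := by
  change ∑ i ∈ Finset.range 0, u i = 0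
  simp

theorem prefixSum_add_one (u : ℤ → ℤ) (k : ℤ) : prefixSum u (k + 1) = prefixSum u k + u k := by
  match k with
  | .ofNat m =>
    change ∑ i ∈ Finset.range (m + 1), u i = ∑ i ∈ Finset.range m, u i + u m
    rw [Finset.sum_range_succ]
  | .negSucc 0 =>
    change ∑ i ∈ Finset.range 0, u i = -∑ i ∈ Finset.range 1, u (-((i : ℤ) + 1)) + u (-1)
    simp
  | .negSucc (m + 1) =>
    change -∑ i ∈ Finset.range (m + 1), u (-((i : ℤ) + 1)) =
      -∑ i ∈ Finset.range (m + 1 + 1), u (-((i : ℤ) + 1)) + u (Int.negSucc (m + 1))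
    rw [Finset.sum_range_succ _ (m + 1), Int.negSucc_eq]
    ring

theorem eq_prefixSum {u G : ℤ → ℤ} (h0 : G 0 = 0) (h : ∀ k, G (k + 1) = G k + u k) (k : ℤ) :
    G k = prefixSum u k := by
  induction k using Int.induction_on with
  | zero => rw [h0, prefixSum_zero]
  | succ i ih => rw [h, prefixSum_add_one, ih]
  | pred i ih =>
    have h1 := h (-(i : ℤ) - 1)
    have h2 := prefixSum_add_one u (-(i : ℤ) - 1)
    rw [sub_add_cancel] at h1 h2
    linarith

variable {n : ℕ}

/-- The function on `ℤ` that vanishes at `0` and has the `n`-periodic differences `u`. -/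
def potential (u : ZMod n → ℤ) (k : ℤ) : ℤ :=
  prefixSum (fun j => u (j : ZMod n)) k

theorem potential_zero (u : ZMod n → ℤ) : potential u 0 = 0 := prefixSum_zero _

theorem potential_add_one (u : ZMod n → ℤ) (k : ℤ) :
    potential u (k + 1) = potential u k + u (k : ZMod n) := prefixSum_add_one _ _

theorem eq_potential {u : ZMod n → ℤ} {G : ℤ → ℤ} (h0 : G 0 = 0)
    (h : ∀ k : ℤ, G (k + 1) = G k + u (k : ZMod n)) (k : ℤ) : G k = potential u k :=
  eq_prefixSum h0 h k

theorem potential_period [NeZero n] (u : ZMod n → ℤ) : potential u n = ∑ i, u i := by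
  change ∑ i ∈ Finset.range n, u ((i : ℤ) : ZMod n) = ∑ i, u i
  refine Finset.sum_bij (fun i _ => (i : ZMod n)) (fun _ _ => Finset.mem_univ _) ?_ ?_ ?_
  · intro a ha b hb hab
    rw [Finset.mem_range] at ha hb
    have := congrArg ZMod.val hab
    rwa [ZMod.val_natCast_of_lt ha, ZMod.val_natCast_of_lt hb] at this
  · intro b _
    exact ⟨b.val, Finset.mem_range.mpr (ZMod.val_lt b), ZMod.natCast_zmod_val b⟩
  · intro i _
    simp

theorem potential_add_period [NeZero n] (u : ZMod n → ℤ) (k : ℤ) :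
    potential u (k + n) = potential u k + ∑ i, u i := by
  have h := eq_potential (u := u) (G := fun k => potential u (k + n) - ∑ i, u i)
    (by simp [potential_period]) (fun k => by
      rw [add_right_comm, potential_add_one]
      simp only [Int.cast_add, Int.cast_natCast, CharP.cast_eq_zero, add_zero]
      ring) k
  linarith

theorem potential_add_mul_period [NeZero n] (u : ZMod n → ℤ) (k t : ℤ) :
    potential u (k + n * t) = potential u k + t * ∑ i, u i := by
  induction t using Int.induction_on with
  | zero => simp
  | succ t ih => rw [mul_add, mul_one, ← add_assoc, potential_add_period, ih]; ring
  | pred t ih =>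
    have := potential_add_period u (k + n * (-(t : ℤ) - 1))
    rw [show k + n * (-(t : ℤ) - 1) + n = k + n * (-(t : ℤ)) by ring, ih] at this
    linarith

/-- With nonnegative drift per period, a lower bound on one period controls everything to the right
of `k`. -/
theorem exists_isLeast_potential [NeZero n] (u : ZMod n → ℤ) (hu : 0 ≤ ∑ i, u i) (k : ℤ) :
    ∃ m, IsLeast (potential u '' Set.Ici k) m := by
  have hn : (0 : ℤ) < n := by exact_mod_cast Nat.pos_of_ne_zero (NeZero.ne n)
  obtain ⟨b, hb⟩ := ((Finset.Ico (0 : ℤ) n).image (potential u)).bddBelow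
  have hbdd : ∀ j, k ≤ j → b + k / n * ∑ i, u i ≤ potential u j := fun j hj => by
    have h1 := potential_add_mul_period u (j % n) (j / n)
    rw [Int.emod_add_mul_ediv] at h1
    have h2 : b ≤ potential u (j % n) := hb (by
      rw [Finset.mem_coe, Finset.mem_image]
      exact ⟨j % n, Finset.mem_Ico.mpr ⟨Int.emod_nonneg _ hn.ne', Int.emod_lt_of_pos _ hn⟩, rfl⟩)
    have h3 := mul_le_mul_of_nonneg_right (Int.ediv_le_ediv hn hj) hu
    linarith
  obtain ⟨m, hm, hm'⟩ := Int.exists_least_of_bdd (P := fun z => z ∈ potential u '' Set.Ici k)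
    ⟨_, by rintro _ ⟨j, hj, rfl⟩; exact hbdd j hj⟩ ⟨_, k, Set.self_mem_Ici, rfl⟩
  exact ⟨m, hm, fun z hz => hm' z hz⟩

end Potential

/-! ### Shadows and the number of free edges. -/

section Grading

variable {n : ℕ}

/-- The potential with a step `1` at each edge in `H` and a step `-f i` at each edge `i ∉ H`. -/
def backPotential (H : Finset (ZMod n)) (f : ZMod n → ℕ) : ℤ → ℤ :=
  potential fun i => if i ∈ H then 1 else -(f i : ℤ)

/-- The potential with a step `g i` at each edge `i ∈ H` and a step `-1` at each edge outside. -/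
def forwPotential (H : Finset (ZMod n)) (g : ZMod n → ℕ) : ℤ → ℤ :=
  potential fun i => if i ∈ H then (g i : ℤ) else -1

/-- Compatibility of gradings `f` of the vertical edges and `g` of the horizontal edges of an
`n`-periodic path. The horizontal edges are those in `H`. -/
def Compatible (H : Finset (ZMod n)) (f g : ZMod n → ℕ) : Prop :=
  ∀ h v : ℤ, h < v → (h : ZMod n) ∈ H → (v : ZMod n) ∉ H → ∃ e, h < e ∧ e ≤ v ∧
    (backPotential H f e ≤ backPotential H f (v + 1) ∨ forwPotential H g e ≤ forwPotential H g h)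

/-- A horizontal edge is free if it is outside the shadows of all vertical edges. -/
def IsFree (H : Finset (ZMod n)) (f : ZMod n → ℕ) (k : ℤ) : Prop :=
  (k : ZMod n) ∈ H ∧ ∀ j, k < j → backPotential H f k < backPotential H f j

variable {H : Finset (ZMod n)} {f g : ZMod n → ℕ}

theorem backPotential_add_one_of_mem {k : ℤ} (hk : (k : ZMod n) ∈ H) :
    backPotential H f (k + 1) = backPotential H f k + 1 := by
  rw [backPotential, potential_add_one, if_pos hk]

theorem backPotential_add_one_of_notMem {k : ℤ} (hk : (k : ZMod n) ∉ H) :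
    backPotential H f (k + 1) = backPotential H f k - f k := by
  rw [backPotential, potential_add_one, if_neg hk, sub_eq_add_neg]

theorem forwPotential_add_one_of_mem {k : ℤ} (hk : (k : ZMod n) ∈ H) :
    forwPotential H g (k + 1) = forwPotential H g k + g k := by
  rw [forwPotential, potential_add_one, if_pos hk]

theorem forwPotential_add_one_of_notMem {k : ℤ} (hk : (k : ZMod n) ∉ H) :
    forwPotential H g (k + 1) = forwPotential H g k - 1 := by
  rw [forwPotential, potential_add_one, if_neg hk, sub_eq_add_neg]

theorem IsFree.add_mul_period [NeZero n] {k : ℤ} (hk : IsFree H f k) (t : ℤ) :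
    IsFree H f (k + n * t) := by
  refine ⟨by simpa using hk.1, fun j hj => ?_⟩
  have h := hk.2 (j - n * t) (by linarith)
  have h1 := potential_add_mul_period (fun i => if i ∈ H then 1 else -(f i : ℤ)) (j - n * t) t
  have h2 := potential_add_mul_period (fun i => if i ∈ H then 1 else -(f i : ℤ)) k t
  rw [sub_add_cancel] at h1
  unfold backPotential at h ⊢
  linarith

open Classical in
/-- The set of free edges in a period. -/
noncomputable def freeSet [NeZero n] (H : Finset (ZMod n)) (f : ZMod n → ℕ) : Finset (ZMod n) :=
  Finset.univ.filter fun i => ∃ k : ℤ, (k : ZMod n) = i ∧ IsFree H f k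

theorem mem_freeSet [NeZero n] {i : ZMod n} :
    i ∈ freeSet H f ↔ ∃ k : ℤ, (k : ZMod n) = i ∧ IsFree H f k := by
  classical
  simp [freeSet]

theorem coe_mem_freeSet [NeZero n] {k : ℤ} : (k : ZMod n) ∈ freeSet H f ↔ IsFree H f k := by
  rw [mem_freeSet]
  refine ⟨?_, fun h => ⟨k, rfl, h⟩⟩
  rintro ⟨j, hj, hfree⟩
  rw [ZMod.intCast_eq_intCast_iff_dvd_sub] at hj
  obtain ⟨t, ht⟩ := hj
  have := hfree.add_mul_period t
  rwa [← ht, add_sub_cancel] at this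

theorem freeSet_subset [NeZero n] : freeSet H f ⊆ H := by
  intro i hi
  rw [mem_freeSet] at hi
  obtain ⟨k, rfl, hk⟩ := hi
  exact hk.1

theorem sum_backPotential_step [NeZero n] {p : ℕ} (hf : f ∈ Finset.piAntidiag Hᶜ p) :
    ∑ i, (if i ∈ H then 1 else -(f i : ℤ)) = H.card - p := by
  rw [Finset.mem_piAntidiag] at hf
  rw [Finset.sum_ite, ← hf.1]
  simp [Finset.filter_not, Finset.compl_eq_univ_sdiff, sub_eq_add_neg]

/-- Free edges are exactly the places where the minimum over the right half-line increases, which is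
what makes them countable. -/
theorem isLeast_backPotential_add_one [NeZero n] {k m m' : ℤ}
    (hm : IsLeast (backPotential H f '' Set.Ici k) m)
    (hm' : IsLeast (backPotential H f '' Set.Ici (k + 1)) m') :
    m' = m + if (k : ZMod n) ∈ freeSet H f then 1 else 0 := by
  obtain ⟨⟨x, hx, hx'⟩, hm⟩ := hm
  obtain ⟨⟨y, hy, hy'⟩, hm'⟩ := hm'
  rw [Set.mem_Ici] at hx hy
  have hk : m ≤ backPotential H f k := hm ⟨k, Set.self_mem_Ici, rfl⟩
  have hk1 : m' ≤ backPotential H f (k + 1) := hm' ⟨k + 1, Set.self_mem_Ici, rfl⟩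
  have hmm : m ≤ m' := hm ⟨y, by rw [Set.mem_Ici]; omega, hy'⟩
  split_ifs with hfree
  · rw [coe_mem_freeSet] at hfree
    rw [backPotential_add_one_of_mem hfree.1] at hk1
    have := hfree.2 y (by omega)
    have hxk : x = k := by
      by_contra hne
      have := hfree.2 x (by omega)
      omega
    rw [hxk] at hx'
    omega
  · rw [coe_mem_freeSet] at hfree
    -- At an edge that is not free, the minimum from `k + 1` on also bounds the value at `k`: a
    -- horizontal edge violating this would be free, and a vertical edge never goes up.
    have hm'k : m' ≤ backPotential H f k := by
      by_cases hH : (k : ZMod n) ∈ H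
      · by_contra hlt
        exact hfree ⟨hH, fun j hj => by
          have : m' ≤ backPotential H f j := hm' ⟨j, by rw [Set.mem_Ici]; omega, rfl⟩
          omega⟩
      · rw [backPotential_add_one_of_notMem hH] at hk1
        omega
    rcases eq_or_lt_of_le hx with rfl | hlt
    · omega
    · have : m' ≤ backPotential H f x := hm' ⟨x, by rw [Set.mem_Ici]; omega, rfl⟩
      omega

/-- Over one period the running minimum rises by one per free edge, and also by the total drift
`H.card - p`. The bound on `p` ensures that the minima exist. -/
theorem card_freeSet_add [NeZero n] {p : ℕ} (hf : f ∈ Finset.piAntidiag Hᶜ p) (hp : p ≤ H.card) :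
    (freeSet H f).card + p = H.card := by
  have hsum := sum_backPotential_step hf
  choose M hM using exists_isLeast_potential (fun i => if i ∈ H then 1 else -(f i : ℤ))
    (by rw [hsum]; have : (p : ℤ) ≤ H.card := by exact_mod_cast hp
        linarith)
  have h1 := eq_potential (u := fun i => if i ∈ freeSet H f then 1 else 0) (G := fun k => M k - M 0)
    (sub_self _) (fun k => by rw [isLeast_backPotential_add_one (hM k) (hM (k + 1))]; ring) n
  rw [potential_period] at h1
  have h2 : IsLeast (backPotential H f '' Set.Ici (n : ℤ)) (M 0 + (H.card - p)) := by
    obtain ⟨⟨x, hx, hx'⟩, hl⟩ := hM 0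
    refine ⟨⟨x + n, by simpa using hx, ?_⟩, ?_⟩
    · rw [backPotential, potential_add_period, hx', hsum]
    · rintro _ ⟨j, hj, rfl⟩
      have h3 := hl ⟨j - n, by simpa using hj, rfl⟩
      have h4 := potential_add_period (fun i => if i ∈ H then 1 else -(f i : ℤ)) (j - n)
      rw [sub_add_cancel, hsum] at h4
      rw [backPotential, h4]
      linarith
  have h3 := (hM n).unique h2
  simp only [Finset.sum_boole, Finset.filter_mem_eq_inter, Finset.univ_inter] at h1
  omega

end Grading

/-! ### Splitting gradings of a given total. -/

section Antidiagonal

variable {ι : Type*} [DecidableEq ι]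

theorem sum_piAntidiag_eq_sum_antidiagonal {R : Type*} [AddCommMonoid R] {s t : Finset ι}
    (hts : t ⊆ s) (q : ℕ) (φ : (ι → ℕ) → R) :
    ∑ g ∈ Finset.piAntidiag s q, φ g = ∑ x ∈ Finset.HasAntidiagonal.antidiagonal q,
      ∑ g₁ ∈ Finset.piAntidiag (s \ t) x.1, ∑ g₂ ∈ Finset.piAntidiag t x.2, φ (g₁ + g₂) := by
  simp_rw [← Finset.sum_product']
  rw [Finset.sum_sigma']
  have hadd : ∀ g : ι → ℕ,
      (fun i => if i ∈ t then 0 else g i) + (fun i => if i ∈ t then g i else 0) = g := fun g => by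
    ext i
    simp only [Pi.add_apply]
    split_ifs <;> simp
  refine Finset.sum_bij' (fun g _ => ⟨(∑ i ∈ s \ t, g i, ∑ i ∈ t, g i),
    ((fun i => if i ∈ t then 0 else g i), fun i => if i ∈ t then g i else 0)⟩)
    (fun y _ => y.2.1 + y.2.2) ?_ ?_ ?_ ?_ ?_
  · intro g hg
    rw [Finset.mem_piAntidiag] at hg
    simp only [Finset.mem_sigma, Finset.HasAntidiagonal.mem_antidiagonal, Finset.mem_product,
      Finset.mem_piAntidiag, Finset.sum_sdiff hts]
    refine ⟨hg.1, ⟨Finset.sum_congr rfl fun i hi => ?_, fun i hi => ?_⟩,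
      Finset.sum_congr rfl fun i hi => if_pos hi, fun i hi => ?_⟩
    · exact if_neg (Finset.mem_sdiff.mp hi).2
    · split_ifs at hi with h
      · exact absurd rfl hi
      · exact Finset.mem_sdiff.mpr ⟨hg.2 i hi, h⟩
    · by_contra h
      exact hi (if_neg h)
  · rintro ⟨⟨i, j⟩, ⟨g₁, g₂⟩⟩ h
    simp only [Finset.mem_sigma, Finset.HasAntidiagonal.mem_antidiagonal, Finset.mem_product,
      Finset.mem_piAntidiag] at h ⊢
    obtain ⟨hij, ⟨h1, h1'⟩, h2, h2'⟩ := h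
    simp only [Pi.add_apply, Finset.sum_add_distrib]
    refine ⟨?_, fun k hk => ?_⟩
    · rw [← hij, ← h1, ← h2]
      congr 1
      · refine (Finset.sum_subset Finset.sdiff_subset fun k _ hk => ?_).symm
        by_contra h0
        exact hk (h1' k h0)
      · refine (Finset.sum_subset hts fun k _ hk => ?_).symm
        by_contra h0
        exact hk (h2' k h0)
    · by_cases h0 : g₁ k = 0
      · exact hts (h2' k (by omega))
      · exact (Finset.mem_sdiff.mp (h1' k h0)).1
  · intro g _
    exact hadd g
  · rintro ⟨⟨i, j⟩, ⟨g₁, g₂⟩⟩ h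
    simp only [Finset.mem_sigma, Finset.HasAntidiagonal.mem_antidiagonal, Finset.mem_product,
      Finset.mem_piAntidiag] at h
    obtain ⟨hij, ⟨h1, h1'⟩, h2, h2'⟩ := h
    have e1 : ∀ k ∈ t, g₁ k = 0 := fun k hk => by
      by_contra h0
      exact (Finset.mem_sdiff.mp (h1' k h0)).2 hk
    have e2 : ∀ k, k ∉ t → g₂ k = 0 := fun k hk => by
      by_contra h0
      exact hk (h2' k h0)
    have s1 : ∑ k ∈ s \ t, (g₁ + g₂) k = i := by
      rw [← h1]
      refine Finset.sum_congr rfl fun k hk => ?_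
      rw [Pi.add_apply, e2 k (Finset.mem_sdiff.mp hk).2, add_zero]
    have s2 : ∑ k ∈ t, (g₁ + g₂) k = j := by
      rw [← h2]
      refine Finset.sum_congr rfl fun k hk => ?_
      rw [Pi.add_apply, e1 k hk, zero_add]
    have f1 : (fun k => if k ∈ t then 0 else (g₁ + g₂) k) = g₁ := by
      ext k
      split_ifs with hk
      · exact (e1 k hk).symm
      · rw [Pi.add_apply, e2 k hk, add_zero]
    have f2 : (fun k => if k ∈ t then (g₁ + g₂) k else 0) = g₂ := by
      ext k
      split_ifs with hk
      · rw [Pi.add_apply, e1 k hk, zero_add]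
      · exact (e2 k hk).symm
    simp only [s1, s2, f1, f2]
  · intro g _
    simp only [hadd]

theorem coeff_pow_card_eq_sum_piAntidiag [Fintype ι] {R : Type*} [CommSemiring R] (P : PowerSeries R)
    (s : Finset ι) (d : ℕ) :
    PowerSeries.coeff d (P ^ s.card) =
      ∑ g ∈ Finset.piAntidiag s d, ∏ i ∈ s, PowerSeries.coeff (g i) P := by
  rw [← Finset.prod_const, PowerSeries.coeff_prod]
  refine Finset.sum_bij (fun l _ => ⇑l) ?_ (fun _ _ _ _ h => DFunLike.coe_injective h) ?_
    (fun _ _ => rfl)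
  · intro l hl
    rw [Finset.mem_finsuppAntidiag] at hl
    rw [Finset.mem_piAntidiag]
    exact ⟨hl.1, fun i hi => hl.2 (Finsupp.mem_support_iff.mpr hi)⟩
  · intro g hg
    rw [Finset.mem_piAntidiag] at hg
    refine ⟨Finsupp.equivFunOnFinite.symm g, ?_, rfl⟩
    rw [Finset.mem_finsuppAntidiag]
    exact ⟨hg.1, fun i hi => hg.2 i (Finsupp.mem_support_iff.mp hi)⟩

end Antidiagonal

/-! ### Reversal of the path. -/

section Reflection

variable {n : ℕ} {H : Finset (ZMod n)} {f g : ZMod n → ℕ}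

/-- Reversing the path and exchanging the roles of vertical and horizontal edges. -/
theorem Compatible.reflect (hfg : Compatible H f g) {H' : Finset (ZMod n)}
    (hH : ∀ i, i ∈ H' ↔ -1 - i ∉ H) :
    Compatible H' (fun i => g (-1 - i)) (fun i => f (-1 - i)) := by
  -- Edge `i` joins the points `i` and `i + 1`, so `k ↦ -k` on points is `i ↦ -1 - i` on edges; it
  -- interchanges the two potentials.
  have hG : ∀ k, backPotential H' (fun i => g (-1 - i)) k = forwPotential H g (-k) := fun k => by
    refine (eq_potential (G := fun k => forwPotential H g (-k))
      (by simp [forwPotential, potential_zero]) (fun k => ?_) k).symm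
    have := potential_add_one (fun i => if i ∈ H then (g i : ℤ) else -1) (-(k + 1))
    rw [show -(k + 1) + 1 = -k by ring] at this
    rw [forwPotential, this]
    have hk : ((-(k + 1) : ℤ) : ZMod n) = -1 - k := by push_cast; ring
    rw [hk]
    simp only [hH]
    split_ifs <;> ring
  have hK : ∀ k, forwPotential H' (fun i => f (-1 - i)) k = backPotential H f (-k) := fun k => by
    refine (eq_potential (G := fun k => backPotential H f (-k))
      (by simp [backPotential, potential_zero]) (fun k => ?_) k).symm
    have := potential_add_one (fun i => if i ∈ H then 1 else -(f i : ℤ)) (-(k + 1))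
    rw [show -(k + 1) + 1 = -k by ring] at this
    rw [backPotential, this]
    have hk : ((-(k + 1) : ℤ) : ZMod n) = -1 - k := by push_cast; ring
    rw [hk]
    simp only [hH]
    split_ifs <;> ring
  intro h v hhv hh hv
  rw [hH] at hh hv
  rw [not_not] at hv
  obtain ⟨e, he, hev, hGK⟩ := hfg (-1 - v) (-1 - h) (by omega) (by simpa using hv)
    (by simpa using hh)
  refine ⟨-e, by omega, by omega, ?_⟩
  rw [hG, hG, hK, hK, neg_neg, show -(v + 1) = -1 - v by ring]
  rw [show -1 - h + 1 = -h by ring] at hGK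
  exact hGK.symm

end Reflection

/-! ### Generating functions of compatible gradings. -/

section CompatibleSum

variable {n : ℕ} [NeZero n] {H : Finset (ZMod n)} {f g g' : ZMod n → ℕ}

/-- A free edge between `h` and `v` already settles the condition for that pair through `f`; without
one, the condition sees `g` only on edges that are not free. -/
theorem Compatible.congr (hfg : Compatible H f g) (hg : ∀ i, i ∉ freeSet H f → g i = g' i) :
    Compatible H f g' := by
  intro h v hhv hh hv
  by_cases hφ : ∃ k, h ≤ k ∧ k ≤ v ∧ IsFree H f k
  · obtain ⟨k, hhk, hkv, hk⟩ := hφ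
    have hne : k ≠ v := fun h' => hv (h' ▸ hk.1)
    -- The potential just after the free edge exceeds the one before it by one only, and freeness
    -- bounds all later values from below by that.
    refine ⟨k + 1, by omega, by omega, Or.inl ?_⟩
    have := hk.2 (v + 1) (by omega)
    rw [backPotential_add_one_of_mem hk.1]
    omega
  · push Not at hφ
    have hK : ∀ e, h ≤ e → e ≤ v → forwPotential H g' e - forwPotential H g' h =
        forwPotential H g e - forwPotential H g h := by
      intro e he
      induction e, he using Int.leInduction with
      | base => intro; ring
      | succ e he ih =>
        intro hev
        have ih := ih (by omega)
        have hge := hg (e : ZMod n) (fun h' => hφ e he (by omega) (coe_mem_freeSet.mp h'))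
        by_cases heH : (e : ZMod n) ∈ H
        · rw [forwPotential_add_one_of_mem heH, forwPotential_add_one_of_mem heH, hge]
          linarith
        · rw [forwPotential_add_one_of_notMem heH, forwPotential_add_one_of_notMem heH]
          linarith
    obtain ⟨e, he, hev, hGK⟩ := hfg h v hhv hh hv
    refine ⟨e, he, hev, hGK.imp_right fun hle => ?_⟩
    have := hK e he.le hev
    linarith

variable {𝕜 : Type*} [Field 𝕜]

open Classical in
/-- The weighted number of pairs of compatible gradings of the vertical and horizontal edges
of total sizes `p` and `q`. -/
noncomputable def compatibleSum (P₁ P₂ : 𝕜[X]) (H : Finset (ZMod n)) (p q : ℕ) : 𝕜 :=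
  ∑ f ∈ Finset.piAntidiag Hᶜ p, ∑ g ∈ Finset.piAntidiag H q,
    if Compatible H f g then (∏ i ∈ Hᶜ, P₂.coeff (f i)) * ∏ i ∈ H, P₁.coeff (g i) else 0

open Classical in
/-- The part of `compatibleSum` in which the horizontal grading vanishes on the free edges. -/
noncomputable def shadowedSum (P₁ P₂ : 𝕜[X]) (H : Finset (ZMod n)) (p q : ℕ) : 𝕜 :=
  ∑ f ∈ Finset.piAntidiag Hᶜ p, ∑ g ∈ Finset.piAntidiag (H \ freeSet H f) q,
    if Compatible H f g then (∏ i ∈ Hᶜ, P₂.coeff (f i)) * ∏ i ∈ H, P₁.coeff (g i) else 0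

/-- For fixed `f`, split `g` into its parts off and on the free edges. The latter is unconstrained,
so each of the `H.card - p` free edges contributes a factor `P₁`. -/
theorem mk_compatibleSum (P₁ P₂ : 𝕜[X]) (hP₁ : P₁.coeff 0 = 1) (p : ℕ) (hp : p ≤ H.card) :
    PowerSeries.mk (compatibleSum P₁ P₂ H p) =
      PowerSeries.mk (shadowedSum P₁ P₂ H p) * (P₁ : PowerSeries 𝕜) ^ (H.card - p) := by
  ext q
  rw [PowerSeries.coeff_mk, PowerSeries.coeff_mul]
  simp_rw [PowerSeries.coeff_mk, compatibleSum, shadowedSum, Finset.sum_mul]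
  conv_rhs => rw [Finset.sum_comm]
  refine Finset.sum_congr rfl fun f hf => ?_
  have hcard : H.card - p = (freeSet H f).card := by
    have := card_freeSet_add hf hp
    omega
  rw [sum_piAntidiag_eq_sum_antidiagonal (freeSet_subset (f := f))]
  refine Finset.sum_congr rfl fun x _ => Finset.sum_congr rfl fun g₁ hg₁ => ?_
  rw [hcard, coeff_pow_card_eq_sum_piAntidiag, Finset.mul_sum]
  refine Finset.sum_congr rfl fun g₂ hg₂ => ?_
  rw [Finset.mem_piAntidiag] at hg₁ hg₂
  have e1 : ∀ k ∈ freeSet H f, g₁ k = 0 := fun k hk => by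
    by_contra h0
    exact (Finset.mem_sdiff.mp (hg₁.2 k h0)).2 hk
  have e2 : ∀ k, k ∉ freeSet H f → g₂ k = 0 := fun k hk => by
    by_contra h0
    exact hk (hg₂.2 k h0)
  have hcomp : Compatible H f (g₁ + g₂) ↔ Compatible H f g₁ :=
    ⟨fun h => h.congr fun i hi => by rw [Pi.add_apply, e2 i hi, add_zero],
      fun h => h.congr fun i hi => by rw [Pi.add_apply, e2 i hi, add_zero]⟩
  have hprod : ∏ i ∈ H, P₁.coeff ((g₁ + g₂) i) =
      (∏ i ∈ H, P₁.coeff (g₁ i)) * ∏ i ∈ freeSet H f, P₁.coeff (g₂ i) := by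
    rw [Finset.prod_subset freeSet_subset fun k _ hk => by rw [e2 k hk, hP₁],
      ← Finset.prod_mul_distrib]
    refine Finset.prod_congr rfl fun k _ => ?_
    by_cases hk : k ∈ freeSet H f
    · rw [Pi.add_apply, e1 k hk, zero_add, hP₁, one_mul]
    · rw [Pi.add_apply, e2 k hk, add_zero, hP₁, mul_one]
  simp only [hprod, Polynomial.coeff_coe, ite_mul, zero_mul]
  classical exact if_congr hcomp (mul_assoc _ _ _).symm rfl

theorem shadowedSum_nonneg [LinearOrder 𝕜] [IsStrictOrderedRing 𝕜] (P₁ P₂ : 𝕜[X])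
    (hP₁ : ∀ i, 0 ≤ P₁.coeff i) (hP₂ : ∀ i, 0 ≤ P₂.coeff i) (p q : ℕ) :
    0 ≤ shadowedSum P₁ P₂ H p q := by
  refine Finset.sum_nonneg fun f _ => Finset.sum_nonneg fun g _ => ?_
  split_ifs
  · exact mul_nonneg (Finset.prod_nonneg fun i _ => hP₂ _) (Finset.prod_nonneg fun i _ => hP₁ _)
  · exact le_rfl

theorem compatibleSum_nonneg [LinearOrder 𝕜] [IsStrictOrderedRing 𝕜] (P₁ P₂ : 𝕜[X])
    (hP₁ : ∀ i, 0 ≤ P₁.coeff i) (hP₂ : ∀ i, 0 ≤ P₂.coeff i) (p q : ℕ) :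
    0 ≤ compatibleSum P₁ P₂ H p q := by
  refine Finset.sum_nonneg fun f _ => Finset.sum_nonneg fun g _ => ?_
  split_ifs
  · exact mul_nonneg (Finset.prod_nonneg fun i _ => hP₂ _) (Finset.prod_nonneg fun i _ => hP₁ _)
  · exact le_rfl

theorem compatibleSum_zero_zero (P₁ P₂ : 𝕜[X]) (hP₁ : P₁.coeff 0 = 1) (hP₂ : P₂.coeff 0 = 1) :
    compatibleSum P₁ P₂ H 0 0 = 1 := by
  have hc : Compatible H 0 0 := fun h v hhv _ hv => ⟨v, hhv, le_rfl, Or.inl (by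
    rw [backPotential_add_one_of_notMem hv]
    simp)⟩
  simp [compatibleSum, Finset.piAntidiag_zero, hc, hP₁, hP₂]

theorem compatibleSum_reflect (P₁ P₂ : 𝕜[X]) {H' : Finset (ZMod n)}
    (hH : ∀ i, i ∈ H' ↔ -1 - i ∉ H) (p q : ℕ) :
    compatibleSum P₁ P₂ H p q = compatibleSum P₂ P₁ H' q p := by
  classical
  have hH' : ∀ i, i ∈ H ↔ -1 - i ∉ H' := fun i => by
    rw [hH, sub_sub_cancel, not_not]
  have hinv : ∀ u : ZMod n → ℕ, (fun i => (fun j => u (-1 - j)) (-1 - i)) = u := fun u => by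
    ext i
    simp
  have hmem : ∀ (s t : Finset (ZMod n)) (_ : ∀ i, i ∈ t ↔ -1 - i ∈ s) (u : ZMod n → ℕ) (m : ℕ),
      u ∈ Finset.piAntidiag s m → (fun i => u (-1 - i)) ∈ Finset.piAntidiag t m := by
    intro s t hst u m hu
    rw [Finset.mem_piAntidiag] at hu ⊢
    refine ⟨?_, fun i hi => (hst i).mpr (hu.2 _ hi)⟩
    rw [← hu.1]
    exact Finset.sum_equiv (Equiv.subLeft (-1)) (fun i => by simp [hst]) (fun i _ => by simp)
  have hprod : ∀ (P : 𝕜[X]) (s t : Finset (ZMod n)) (_ : ∀ i, i ∈ t ↔ -1 - i ∈ s)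
      (u : ZMod n → ℕ), ∏ i ∈ s, P.coeff (u i) = ∏ i ∈ t, P.coeff (u (-1 - i)) := by
    intro P s t hst u
    exact Finset.prod_equiv (Equiv.subLeft (-1)) (fun i => by simp [hst]) (fun i _ => by simp)
  have h1 : ∀ i, i ∈ H' ↔ -1 - i ∈ Hᶜ := fun i => by rw [hH, Finset.mem_compl]
  have h2 : ∀ i, i ∈ H'ᶜ ↔ -1 - i ∈ H := fun i => by rw [hH', sub_sub_cancel, Finset.mem_compl]
  have h3 : ∀ i, i ∈ Hᶜ ↔ -1 - i ∈ H' := fun i => by rw [hH, sub_sub_cancel, Finset.mem_compl]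
  have h4 : ∀ i, i ∈ H ↔ -1 - i ∈ H'ᶜ := fun i => by rw [hH', Finset.mem_compl]
  rw [compatibleSum, compatibleSum, Finset.sum_comm]
  refine Finset.sum_bij' (fun g _ i => g (-1 - i)) (fun g _ i => g (-1 - i))
    (fun g hg => hmem _ _ h2 g q hg) (fun g hg => hmem _ _ h4 g q hg)
    (fun g _ => hinv g) (fun g _ => hinv g) fun g _ => ?_
  refine Finset.sum_bij' (fun g _ i => g (-1 - i)) (fun g _ i => g (-1 - i))
    (fun g hg => hmem _ _ h1 g p hg) (fun g hg => hmem _ _ h3 g p hg)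
    (fun g _ => hinv g) (fun g _ => hinv g) fun f _ => ?_
  have hiff : Compatible H f g ↔
      Compatible H' (fun i => g (-1 - i)) (fun i => f (-1 - i)) := by
    refine ⟨fun h => h.reflect hH, fun h => ?_⟩
    have := h.reflect hH'
    simpa only [sub_sub_cancel] using this
  rw [hprod P₂ _ _ h1 f, hprod P₁ _ _ h2 g, mul_comm]
  exact if_congr hiff rfl rfl

end CompatibleSum

/-! ### The slope inequality for gradings that vanish on free edges. -/

section Support

variable {n : ℕ} {H : Finset (ZMod n)} {f g : ZMod n → ℕ}

/-- A first return of `backPotential` gives a stretch of the path in which a compatible horizontal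
grading is small compared with the vertical one. -/
theorem Compatible.lt_of_first_return (hfg : Compatible H f g) {a b : ℤ} (ha : 0 < a) {T : ℤ → ℤ}
    (hT_nonneg : ∀ k, 0 ≤ T k) (hT_lt : ∀ k : ℤ, (k : ZMod n) ∈ H → T k < a)
    (hT : ∀ k : ℤ, T (k + 1) = T k + if (k : ZMod n) ∈ H then b else -a)
    (hf : ∀ i ∈ H, f i = 0) (hg : ∀ i, i ∉ H → g i = 0) {x z : ℤ} (hxz : x < z)
    (hx : (x : ZMod n) ∈ H) (hz : backPotential H f z = backPotential H f x)
    (hlt : ∀ e, x < e → e < z → backPotential H f x < backPotential H f e) :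
    a * (potential (fun i => (g i : ℤ)) z - potential (fun i => (g i : ℤ)) x) <
      b * (potential (fun i => (f i : ℤ)) z - potential (fun i => (f i : ℤ)) x) := by
  -- Both sides are `b` times the number of horizontal edges minus `a` times the number of vertical
  -- edges, counted from `0`.
  have hinv : ∀ k, T k - T 0 = b * (backPotential H f k + potential (fun i => (f i : ℤ)) k) -
      a * (potential (fun i => (g i : ℤ)) k - forwPotential H g k) := by
    intro k
    refine (eq_potential (u := fun i => if i ∈ H then b else -a) (G := fun k => T k - T 0)
      (sub_self _) (fun k => by rw [hT]; ring) k).trans (eq_potential (G := fun k =>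
        b * (backPotential H f k + potential (fun i => (f i : ℤ)) k) -
          a * (potential (fun i => (g i : ℤ)) k - forwPotential H g k)) ?_ (fun k => ?_) k).symm
    · simp [backPotential, forwPotential, potential_zero]
    · by_cases hk : (k : ZMod n) ∈ H
      · rw [backPotential_add_one_of_mem hk, forwPotential_add_one_of_mem hk, potential_add_one,
          potential_add_one, if_pos hk, hf _ hk]
        push_cast
        ring
      · rw [backPotential_add_one_of_notMem hk, forwPotential_add_one_of_notMem hk,
          potential_add_one, potential_add_one, if_neg hk, hg _ hk]
        push_cast
        ring
  have hx1 := backPotential_add_one_of_mem (f := f) hx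
  have hxz1 : x + 1 < z := by
    by_contra h
    have : z = x + 1 := by omega
    rw [this] at hz
    omega
  obtain ⟨v, rfl⟩ : ∃ v, z = v + 1 := ⟨z - 1, by ring⟩
  have hv : (v : ZMod n) ∉ H := fun hv => by
    have h1 := backPotential_add_one_of_mem (f := f) hv
    have h2 := hlt v (by omega) (by omega)
    omega
  -- Before the first return the `backPotential` alternative of compatibility is impossible, so the
  -- `forwPotential` one holds and can be chained up to `v`.
  have hK : ∀ m : ℕ, ∀ h : ℤ, x ≤ h → h ≤ v → (v - h).toNat = m →
      forwPotential H g v ≤ forwPotential H g h := by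
    intro m
    induction m using Nat.strong_induction_on with
    | _ m ih =>
      intro h hxh hhv hm
      rcases eq_or_lt_of_le hhv with rfl | hhv
      · exact le_rfl
      · by_cases hh : (h : ZMod n) ∈ H
        · obtain ⟨e, he, hev, hGK⟩ := hfg h v hhv hh hv
          have h1 := hlt e (by omega) (by omega)
          have h2 := ih (v - e).toNat (by omega) e (by omega) hev rfl
          omega
        · have h1 := ih (v - (h + 1)).toNat (by omega) (h + 1) (by omega) (by omega) rfl
          rw [forwPotential_add_one_of_notMem hh] at h1
          omega
  -- The vertical edge `v` lowers `forwPotential` by one more, hence by at least `1` in total,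
  -- whereas `T (v + 1) - T x > -a`; this yields the strict inequality.
  have h1 := hK _ x le_rfl (by omega) rfl
  have h2 := forwPotential_add_one_of_notMem (g := g) hv
  have h3 := hinv (v + 1)
  have h4 := hinv x
  have h5 := hT_nonneg (v + 1)
  have h6 := hT_lt x hx
  have h7 : a * (forwPotential H g (v + 1) - forwPotential H g x) ≤ a * (-1) :=
    mul_le_mul_of_nonneg_left (by omega) ha.le
  rw [hz] at h3
  linarith

/-- Cut the path between two right-minima of `backPotential` into first-return excursions and single
edges on which both gradings vanish. Every excursion contributes a strict inequality, so equality
needs trivial gradings. -/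
theorem Compatible.lt_of_eq_zero_on_free (hfg : Compatible H f g) {a b : ℤ} (ha : 0 < a)
    {T : ℤ → ℤ}
    (hT_nonneg : ∀ k, 0 ≤ T k) (hT_lt : ∀ k : ℤ, (k : ZMod n) ∈ H → T k < a)
    (hT : ∀ k : ℤ, T (k + 1) = T k + if (k : ZMod n) ∈ H then b else -a)
    (hf : ∀ i ∈ H, f i = 0) (hg : ∀ i, i ∉ H → g i = 0)
    (hfree : ∀ k : ℤ, IsFree H f k → g (k : ZMod n) = 0) {x y : ℤ} (hxy : x ≤ y)
    (hx : ∀ j, x ≤ j → backPotential H f x ≤ backPotential H f j)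
    (hy : ∀ j, y ≤ j → backPotential H f y ≤ backPotential H f j) :
    (potential (fun i => (f i : ℤ)) y = potential (fun i => (f i : ℤ)) x ∧
      potential (fun i => (g i : ℤ)) y = potential (fun i => (g i : ℤ)) x) ∨
    a * (potential (fun i => (g i : ℤ)) y - potential (fun i => (g i : ℤ)) x) <
      b * (potential (fun i => (f i : ℤ)) y - potential (fun i => (f i : ℤ)) x) := by
  induction hm : (y - x).toNat using Nat.strong_induction_on generalizing x with
  | _ m ih =>
    rcases eq_or_lt_of_le hxy with rfl | hlt
    · exact Or.inl ⟨rfl, rfl⟩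
    have hstep : f (x : ZMod n) = 0 → g (x : ZMod n) = 0 →
        (∀ j, x + 1 ≤ j → backPotential H f (x + 1) ≤ backPotential H f j) →
        (potential (fun i => (f i : ℤ)) y = potential (fun i => (f i : ℤ)) x ∧
          potential (fun i => (g i : ℤ)) y = potential (fun i => (g i : ℤ)) x) ∨
        a * (potential (fun i => (g i : ℤ)) y - potential (fun i => (g i : ℤ)) x) <
          b * (potential (fun i => (f i : ℤ)) y - potential (fun i => (f i : ℤ)) x) := by
      intro hf0 hg0 hx1
      have h := ih (y - (x + 1)).toNat (by omega) (x := x + 1) (by omega) hx1 rfl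
      simpa only [potential_add_one, hf0, hg0, Nat.cast_zero, add_zero] using h
    by_cases hxH : (x : ZMod n) ∈ H
    · by_cases hxfree : IsFree H f x
      · refine hstep (hf _ hxH) (hfree x hxfree) fun j hj => ?_
        rw [backPotential_add_one_of_mem hxH]
        exact hxfree.2 j (by omega)
      · have hex : ∃ j, x < j ∧ backPotential H f j ≤ backPotential H f x := by
          by_contra hcon
          push Not at hcon
          exact hxfree ⟨hxH, hcon⟩
        obtain ⟨z, ⟨hxz, hz⟩, hmin⟩ := Int.exists_least_of_bdd
          (P := fun j => x < j ∧ backPotential H f j ≤ backPotential H f x)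
          ⟨x, fun j hj => hj.1.le⟩ hex
        have hz' : backPotential H f z = backPotential H f x := le_antisymm hz (hx z hxz.le)
        have hlt' : ∀ e, x < e → e < z → backPotential H f x < backPotential H f e := by
          intro e hxe hez
          by_contra hcon
          have := hmin e ⟨hxe, not_lt.mp hcon⟩
          omega
        -- Otherwise `y` lies strictly inside the excursion, above its later endpoint `z`, and is no
        -- right-minimum.
        have hzy : z ≤ y := by
          by_contra hcon
          have h1 := hlt' y hlt (by omega)
          have h2 := hy z (by omega)
          omega
        have hpiece := hfg.lt_of_first_return ha hT_nonneg hT_lt hT hf hg hxz hxH hz' hlt'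
        rcases ih (y - z).toNat (by omega) hzy
          (fun j hj => hz'.le.trans (hx j (by omega))) rfl with h | h
        · rw [h.1, h.2]
          exact Or.inr hpiece
        · right
          linarith
    · have hx1 := hx (x + 1) (by omega)
      rw [backPotential_add_one_of_notMem hxH] at hx1
      have hf0 : f (x : ZMod n) = 0 := by omega
      refine hstep hf0 (hg _ hxH) fun j hj => ?_
      rw [backPotential_add_one_of_notMem hxH, hf0, Nat.cast_zero, sub_zero]
      exact hx j (by omega)

/-- Apply the decomposition to one full period, beginning at a right-minimum; its translate by `n`
is again one. -/
theorem Compatible.mul_lt_mul [NeZero n] (hfg : Compatible H f g) {a b : ℤ} (ha : 0 < a)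
    {T : ℤ → ℤ}
    (hT_nonneg : ∀ k, 0 ≤ T k) (hT_lt : ∀ k : ℤ, (k : ZMod n) ∈ H → T k < a)
    (hT : ∀ k : ℤ, T (k + 1) = T k + if (k : ZMod n) ∈ H then b else -a) {p q : ℕ}
    (hp : p ≤ H.card) (hf : f ∈ Finset.piAntidiag Hᶜ p)
    (hg : g ∈ Finset.piAntidiag (H \ freeSet H f) q) (h0 : ¬(p = 0 ∧ q = 0)) :
    a * (q : ℤ) < b * p := by
  have hsum := sum_backPotential_step hf
  have hnonneg : 0 ≤ ∑ i, (if i ∈ H then 1 else -(f i : ℤ)) := by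
    rw [hsum]
    have : (p : ℤ) ≤ H.card := by exact_mod_cast hp
    linarith
  obtain ⟨_, ⟨x, hx0, rfl⟩, hx⟩ := exists_isLeast_potential _ hnonneg 0
  rw [Set.mem_Ici] at hx0
  have hxmin : ∀ j, x ≤ j → backPotential H f x ≤ backPotential H f j := fun j hj =>
    hx ⟨j, hx0.trans hj, rfl⟩
  have hymin : ∀ j, x + n ≤ j → backPotential H f (x + n) ≤ backPotential H f j := by
    intro j hj
    have h1 := hxmin (j - n) (by omega)
    have h2 := potential_add_period (fun i => if i ∈ H then 1 else -(f i : ℤ)) (j - n)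
    have h3 := potential_add_period (fun i => if i ∈ H then 1 else -(f i : ℤ)) x
    rw [sub_add_cancel] at h2
    unfold backPotential at h1 ⊢
    omega
  rw [Finset.mem_piAntidiag] at hf hg
  have hfp : ∑ i, (f i : ℤ) = p := by
    rw [← hf.1, Nat.cast_sum, eq_comm]
    refine Finset.sum_subset (Finset.subset_univ _) fun i _ hi => ?_
    by_contra h
    exact hi (hf.2 i (by simpa using h))
  have hgq : ∑ i, (g i : ℤ) = q := by
    rw [← hg.1, Nat.cast_sum, eq_comm]
    refine Finset.sum_subset (Finset.subset_univ _) fun i _ hi => ?_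
    by_contra h
    exact hi (hg.2 i (by simpa using h))
  have key := hfg.lt_of_eq_zero_on_free ha hT_nonneg hT_lt hT
    (fun i hi => by
      by_contra h
      exact Finset.mem_compl.mp (hf.2 i h) hi)
    (fun i hi => by
      by_contra h
      exact hi (Finset.mem_sdiff.mp (hg.2 i h)).1)
    (fun k hk => by
      by_contra h
      exact (Finset.mem_sdiff.mp (hg.2 _ h)).2 (coe_mem_freeSet.mpr hk))
    (show x ≤ x + n by omega) hxmin hymin
  simp only [potential_add_period, hfp, hgq, add_sub_cancel_left] at key
  rcases key with h | h
  · exact absurd (by omega) h0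
  · exact h

end Support

/-! ### The cyclic Christoffel path. -/

section Christoffel

/-- The horizontal edges of the cyclic Christoffel path with `a` horizontal and `b` vertical edges,
where `n = a + b`. -/
def christoffel (n a b : ℕ) [NeZero n] : Finset (ZMod n) :=
  Finset.univ.filter fun i => ((b : ZMod n) * i).val < a

variable {n a b : ℕ} [NeZero n]

theorem mem_christoffel {i : ZMod n} : i ∈ christoffel n a b ↔ ((b : ZMod n) * i).val < a := by
  simp [christoffel]

theorem ZMod.val_add_natCast_of_eq_add (hn : n = a + b) (x : ZMod n) :
    ((x + (b : ZMod n)).val : ℤ) = x.val + if x.val < a then (b : ℤ) else -a := by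
  have hx := ZMod.val_lt x
  rw [ZMod.val_add, ZMod.val_natCast, Nat.add_mod_mod]
  split_ifs with h
  · rw [Nat.mod_eq_of_lt (by omega)]
    push_cast
    ring
  · rw [Nat.mod_eq_sub_mod (by omega), Nat.mod_eq_of_lt (by omega)]
    omega

/-- The residue of `b * k` modulo `n` serves as the height `T` of the slope inequality. -/
theorem val_mul_add_one (hn : n = a + b) (k : ℤ) :
    (((b : ZMod n) * ((k + 1 : ℤ) : ZMod n)).val : ℤ) = ((b : ZMod n) * (k : ZMod n)).val +
      if (k : ZMod n) ∈ christoffel n a b then (b : ℤ) else -a := by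
  simp only [mem_christoffel]
  rw [← ZMod.val_add_natCast_of_eq_add hn]
  push_cast
  rw [mul_add, mul_one]

/-- The height returns to `0` after a period, so `b` times the number of horizontal edges equals `a`
times the number of vertical ones. -/
theorem card_christoffel (hn : n = a + b) : (christoffel n a b).card = a := by
  have h := eq_potential (u := fun i => if i ∈ christoffel n a b then (b : ℤ) else -a)
    (G := fun k => (((b : ZMod n) * (k : ZMod n)).val : ℤ)) (by simp)
    (fun k => val_mul_add_one hn k) n
  rw [potential_period, Finset.sum_ite] at h
  simp only [Finset.filter_mem_eq_inter, Finset.univ_inter, Finset.filter_not, Finset.sum_const,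
    ← Finset.compl_eq_univ_sdiff, Finset.card_compl, ZMod.card, Int.cast_natCast,
    CharP.cast_eq_zero, mul_zero, ZMod.val_zero, nsmul_eq_mul] at h
  have hle : (christoffel n a b).card ≤ n := by
    simpa [ZMod.card] using Finset.card_le_univ (christoffel n a b)
  rw [Nat.cast_sub hle] at h
  have hn' : (n : ℤ) = a + b := by exact_mod_cast hn
  have hpos : (n : ℤ) ≠ 0 := by exact_mod_cast NeZero.ne n
  have : (n : ℤ) * ((christoffel n a b).card - a) = 0 := by
    rw [hn'] at h ⊢
    linarith
  rcases mul_eq_zero.mp this with h' | h'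
  · exact absurd h' hpos
  · omega

theorem mem_christoffel_swap (hn : n = a + b) (i : ZMod n) :
    i ∈ christoffel n b a ↔ -1 - i ∉ christoffel n a b := by
  have hab : (b : ZMod n) = -(a : ZMod n) := by
    rw [eq_neg_iff_add_eq_zero, add_comm, ← Nat.cast_add, ← hn]
    exact ZMod.natCast_self n
  have h := ZMod.val_add_natCast_of_eq_add (a := b) (b := a) (by omega) ((a : ZMod n) * i)
  rw [mem_christoffel, mem_christoffel, hab,
    show -(a : ZMod n) * (-1 - i) = (a : ZMod n) * i + a by ring]
  have hlt := ZMod.val_lt ((a : ZMod n) * i)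
  split_ifs at h with h' <;> omega

variable {𝕜 : Type*} [Field 𝕜]

theorem shadowedSum_christoffel_eq_zero (P₁ P₂ : 𝕜[X]) (hn : n = a + b) (ha : 0 < a) {p q : ℕ}
    (hp : p ≤ a) (h0 : ¬(p = 0 ∧ q = 0)) (hpq : (b : ℤ) * p ≤ a * q) :
    shadowedSum P₁ P₂ (christoffel n a b) p q = 0 := by
  refine Finset.sum_eq_zero fun f hf => Finset.sum_eq_zero fun g hg => if_neg fun hfg => ?_
  have := hfg.mul_lt_mul (a := a) (b := b) (by exact_mod_cast ha)
    (T := fun k => (((b : ZMod n) * (k : ZMod n)).val : ℤ)) (fun k => Int.natCast_nonneg _)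
    (fun k hk => by exact_mod_cast mem_christoffel.mp hk) (fun k => val_mul_add_one hn k)
    (by rwa [card_christoffel hn]) hf hg h0
  omega

end Christoffel

/-! ### The solution for positive `a₁` and `a₂`, and the conclusion. -/

section PositiveDenominators

variable {𝕜 : Type*} [Field 𝕜]

/-- The greedy coefficients in terms of compatible gradings. -/
noncomputable def gradingCoeff (n : ℕ) [NeZero n] (P₁ P₂ : 𝕜[X]) (a b p q : ℕ) : 𝕜 :=
  if p < a ∨ q < b then compatibleSum P₁ P₂ (christoffel n a b) p q else 0

variable {n : ℕ} [NeZero n] (P₁ P₂ : 𝕜[X]) {a b : ℕ}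

theorem gradingCoeff_swap (hn : n = a + b) (p q : ℕ) :
    gradingCoeff n P₁ P₂ a b p q = gradingCoeff n P₂ P₁ b a q p := by
  rw [gradingCoeff, gradingCoeff, compatibleSum_reflect P₁ P₂ (mem_christoffel_swap hn)]
  exact if_congr or_comm rfl rfl

/-- For `p < a` the cutoff leaves the whole column untouched, so dividing by `P₁ ^ (a - p)` undoes
the factorization of `mk_compatibleSum`. -/
theorem gradingCoeff_sub_greedySum (hP₁ : P₁.coeff 0 = 1) (hn : n = a + b) {p : ℕ} (hp : p < a)
    (q : ℕ) : gradingCoeff n P₁ P₂ a b p q -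
      greedySum P₁ ((a : ℤ) - (p : ℤ)) (fun q' => gradingCoeff n P₁ P₂ a b p q') q =
      shadowedSum P₁ P₂ (christoffel n a b) p q := by
  rw [← Nat.cast_sub hp.le,
    sub_greedySum_of_mk_eq_mul_pow P₁ hP₁ (a - p) (fun q' => gradingCoeff n P₁ P₂ a b p q')
      (PowerSeries.mk (shadowedSum P₁ P₂ (christoffel n a b) p)), PowerSeries.coeff_mk]
  have h := mk_compatibleSum (H := christoffel n a b) P₁ P₂ hP₁ p
    (by rw [card_christoffel hn]; exact hp.le)
  rw [card_christoffel hn] at h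
  rw [← h]
  congr 1
  ext q'
  rw [gradingCoeff, if_pos (Or.inl hp)]

theorem gradingCoeff_eq_greedySum (hP₁ : P₁.coeff 0 = 1) (hn : n = a + b) (ha : 0 < a)
    {p q : ℕ} (h0 : ¬(p = 0 ∧ q = 0)) (hpq : (b : ℤ) * p ≤ a * q)
    (hc : gradingCoeff n P₁ P₂ a b p q ≠ 0) : gradingCoeff n P₁ P₂ a b p q =
      greedySum P₁ ((a : ℤ) - (p : ℤ)) (fun q' => gradingCoeff n P₁ P₂ a b p q') q := by
  rcases lt_or_ge p a with hp | hp
  · rw [← sub_eq_zero, gradingCoeff_sub_greedySum P₁ P₂ hP₁ hn hp]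
    exact shadowedSum_christoffel_eq_zero P₁ P₂ hn ha hp.le h0 hpq
  -- For `p ≥ a` the slope condition forces `q ≥ b`, where the cutoff makes the coefficient zero.
  · have hq : b ≤ q := by
      by_contra hlt
      have h1 : a * q < a * b := Nat.mul_lt_mul_of_pos_left (by omega) ha
      have h2 : b * a ≤ b * p := Nat.mul_le_mul_left b hp
      have h3 : b * p ≤ a * q := by exact_mod_cast hpq
      rw [mul_comm b a] at h2
      omega
    exact absurd (if_neg (by omega)) hc

variable [LinearOrder 𝕜] [IsStrictOrderedRing 𝕜]

theorem gradingCoeff_nonneg (hP₁ : ∀ i, 0 ≤ P₁.coeff i) (hP₂ : ∀ i, 0 ≤ P₂.coeff i) (p q : ℕ) :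
    0 ≤ gradingCoeff n P₁ P₂ a b p q := by
  rw [gradingCoeff]
  split_ifs
  · exact compatibleSum_nonneg P₁ P₂ hP₁ hP₂ p q
  · exact le_rfl

theorem greedySum_le_gradingCoeff (hP₁ : P₁.coeff 0 = 1) (hP₁' : ∀ i, 0 ≤ P₁.coeff i)
    (hP₂' : ∀ i, 0 ≤ P₂.coeff i) (hn : n = a + b) (p q : ℕ) :
    greedySum P₁ ((a : ℤ) - (p : ℤ)) (fun q' => gradingCoeff n P₁ P₂ a b p q') q ≤
      gradingCoeff n P₁ P₂ a b p q := by
  rw [← sub_nonneg]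
  rcases lt_or_ge p a with hp | hp
  · rw [gradingCoeff_sub_greedySum P₁ P₂ hP₁ hn hp]
    exact shadowedSum_nonneg P₁ P₂ hP₁' hP₂' p q
  -- Here `a - p ≤ 0`, so the column is multiplied by a nonnegative power of `P₁`.
  · exact sub_greedySum_nonneg_of_nonpos P₁ hP₁ hP₁' (by omega) _
      (gradingCoeff_nonneg P₁ P₂ hP₁' hP₂' p) q

theorem isGreedySolution_gradingCoeff (hP₁ : P₁.coeff 0 = 1) (hP₂ : P₂.coeff 0 = 1)
    (hP₁' : ∀ i, 0 ≤ P₁.coeff i) (hP₂' : ∀ i, 0 ≤ P₂.coeff i) (hn : n = a + b) (ha : 0 < a)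
    (hb : 0 < b) : IsGreedySolution P₁ P₂ a b (gradingCoeff n P₁ P₂ a b) where
  zero_zero := by rw [gradingCoeff, if_pos (Or.inl ha), compatibleSum_zero_zero P₁ P₂ hP₁ hP₂]
  nonneg := gradingCoeff_nonneg P₁ P₂ hP₁' hP₂'
  horizontal_le p q := by
    simp only [gradingCoeff_swap P₁ P₂ hn]
    exact greedySum_le_gradingCoeff P₂ P₁ hP₂ hP₂' hP₁' (by omega) q p
  vertical_le := greedySum_le_gradingCoeff P₁ P₂ hP₁ hP₁' hP₂' hn
  eq_horizontal p q h0 hpq hc := by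
    simp only [gradingCoeff_swap P₁ P₂ hn] at hc ⊢
    exact gradingCoeff_eq_greedySum P₂ P₁ hP₂ (by omega) hb (fun h => h0 h.symm) hpq hc
  eq_vertical p q h0 hpq hc := gradingCoeff_eq_greedySum P₁ P₂ hP₁ hn ha h0 hpq hc

theorem exists_isGreedySolution (hP₁ : P₁.coeff 0 = 1) (hP₂ : P₂.coeff 0 = 1)
    (hP₁' : ∀ i, 0 ≤ P₁.coeff i) (hP₂' : ∀ i, 0 ≤ P₂.coeff i) (a₁ a₂ : ℤ) :
    ∃ c, IsGreedySolution P₁ P₂ a₁ a₂ c := by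
  rcases le_or_gt a₂ 0 with h₂ | h₂
  · exact ⟨_, isGreedySolution_of_nonpos P₁ P₂ hP₁ hP₂ hP₁' hP₂' a₁ a₂ h₂⟩
  rcases le_or_gt a₁ 0 with h₁ | h₁
  · exact ⟨_, (isGreedySolution_of_nonpos P₂ P₁ hP₂ hP₁ hP₂' hP₁' a₂ a₁ h₁).swap⟩
  lift a₁ to ℕ using h₁.le
  lift a₂ to ℕ using h₂.le
  have : NeZero (a₁ + a₂) := ⟨by omega⟩
  exact ⟨_, isGreedySolution_gradingCoeff (n := a₁ + a₂) P₁ P₂ hP₁ hP₂ hP₁' hP₂' rfl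
    (by omega) (by omega)⟩

end PositiveDenominators

theorem proposition2p8 {𝕜 : Type*} [Field 𝕜] [LinearOrder 𝕜] [IsStrictOrderedRing 𝕜]
    (P₁ P₂ : 𝕜[X])
    (hP₁_monic : P₁.Monic) (hP₂_monic : P₂.Monic)
    (hP₁_palindromic : P₁.reverse = P₁) (hP₂_palindromic : P₂.reverse = P₂)
    (hP₁_nonneg : ∀ i, 0 ≤ P₁.coeff i) (hP₂_nonneg : ∀ i, 0 ≤ P₂.coeff i)
    (a₁ a₂ : ℤ) (p q : ℕ) (hpq : ¬(p = 0 ∧ q = 0)) :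
    (a₁ * (q : ℤ) ≤ a₂ * (p : ℤ) →
      greedyCoeff P₁ P₂ a₁ a₂ p q =
        max (greedySum P₂ (a₂ - (q : ℤ)) (fun p' => greedyCoeff P₁ P₂ a₁ a₂ p' q) p) 0) ∧
    (a₂ * (p : ℤ) ≤ a₁ * (q : ℤ) →
      greedyCoeff P₁ P₂ a₁ a₂ p q =
        max (greedySum P₁ (a₁ - (p : ℤ)) (fun q' => greedyCoeff P₁ P₂ a₁ a₂ p q') q) 0) := by
  -- Palindromicity carries the leading coefficient `1` to the constant term, as the expansion in
  -- powers of `P₁ - 1` requires.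
  have hP₁ : P₁.coeff 0 = 1 := by
    rw [← hP₁_palindromic, coeff_zero_reverse, hP₁_monic.leadingCoeff]
  have hP₂ : P₂.coeff 0 = 1 := by
    rw [← hP₂_palindromic, coeff_zero_reverse, hP₂_monic.leadingCoeff]
  obtain ⟨c, hc⟩ := exists_isGreedySolution P₁ P₂ hP₁ hP₂ hP₁_nonneg hP₂_nonneg a₁ a₂
  simp only [hc.greedyCoeff_eq]
  exact ⟨hc.eq_max_horizontal hpq, hc.eq_max_vertical hpq⟩
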